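/- Let $a,b$ be two bosonic modes with Fock bases $\{|n\rangle\}_{n\ge 0}$, and for $T\in[0,1]$ let $B(T)=\exp\!\big(\arccos(\sqrt T)\,(ab^\dagger-a^\dagger b)\big)$ be the unitary of the beam splitter with transmission probability $T$. Let $|\psi\rangle=\sum_{n\ge 0}\psi_n|n\rangle$ be any pure state of mode $a$, i.e. $\sum_n|\psi_n|^2=1$, let $|\Psi_T\rangle=B(T)\,|\psi\rangle_a\otimes|0\rangle_b$ be the state obtained by interfering it with the vacuum, let $\rho_T=\mathrm{Tr}_b\,|\Psi_T\rangle\langle\Psi_T|$ be its reduced state, and let $\mathcal P_\psi(T)=\mathrm{Tr}[\rho_T^2]$ be the purity of the reduced state. Then $\mathcal P_\psi$ is a convex function of $T$ on $[0,1]$, and it attains its minimum over $[0,1]$ at the balanced point $T=1/2$. Equivalently, the entanglement of $|\Psi_T\rangle$ as measured by the mixedness (linear entropy) $\mathcal M_\psi(T)=1-\mathcal P_\psi(T)$ is concave in $T$ on $[0,1]$ and is maximal at $T=1/2$. -/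

import Mathlib

noncomputable section

namespace BeamSplitter

open Finset
open scoped Matrix ComplexConjugate InnerProductSpace

/-- The state space of one bosonic mode: square-summable amplitudes in the Fock basis. -/
abbrev Fock : Type := lp (fun _ : ℕ => ℂ) 2

/-- The state space of two bosonic modes `a`, `b`; the index `(m, k)` is the Fock state with `m`
photons in mode `a` and `k` photons in mode `b`. -/
abbrev Fock2 : Type := lp (fun _ : ℕ × ℕ => ℂ) 2

/-- The Fock state with `n` photons; `ket 0` is the vacuum. -/
def ket (n : ℕ) : Fock := lp.single 2 n 1

theorem summable_sq {ι : Type*} (f : lp (fun _ : ι => ℂ) 2) : Summable fun i => ‖f i‖ ^ 2 := by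
  have := (lp.memℓp f).summable (by norm_num)
  simpa using this

theorem norm_sq_eq {ι : Type*} (f : lp (fun _ : ι => ℂ) 2) : ‖f‖ ^ 2 = ∑' i, ‖f i‖ ^ 2 := by
  have := lp.norm_rpow_eq_tsum (p := 2) (by norm_num) f
  simpa using this

theorem memℓp_two {ι : Type*} {f : ι → ℂ} (h : Summable fun i => ‖f i‖ ^ 2) : Memℓp f 2 := by
  apply memℓp_gen
  simpa using h

/-! ### Product states -/

/-- The product state `ψ ⊗ χ`, with `ψ` in mode `a` and `χ` in mode `b`. -/
def tensor (ψ χ : Fock) : Fock2 :=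
  ⟨fun p => ψ p.1 * χ p.2, memℓp_two (by
    simpa [mul_pow] using (summable_sq ψ).mul_of_nonneg (summable_sq χ)
      (fun _ => by positivity) (fun _ => by positivity))⟩

theorem norm_tensor (ψ χ : Fock) : ‖tensor ψ χ‖ = ‖ψ‖ * ‖χ‖ := by
  have h : ‖tensor ψ χ‖ ^ 2 = (‖ψ‖ * ‖χ‖) ^ 2 := by
    have hs : Summable fun p : ℕ × ℕ => ‖ψ p.1‖ ^ 2 * ‖χ p.2‖ ^ 2 :=
      (summable_sq ψ).mul_of_nonneg (summable_sq χ)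
        (fun _ => by positivity) (fun _ => by positivity)
    rw [mul_pow, norm_sq_eq, norm_sq_eq ψ, norm_sq_eq χ,
      (summable_sq ψ).tsum_mul_tsum (summable_sq χ) hs]
    simp [tensor, mul_pow]
  exact (pow_left_inj₀ (by positivity) (by positivity) two_ne_zero).1 h

/-- The bounded operator `ψ ↦ ψ ⊗ χ`. -/
def tensorRight (χ : Fock) : Fock →L[ℂ] Fock2 :=
  LinearMap.mkContinuous
    { toFun := fun ψ => tensor ψ χ
      map_add' := fun _ _ => by ext p; exact add_mul _ _ _
      map_smul' := fun _ _ => by ext p; exact mul_assoc _ _ _ }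
    ‖χ‖ (fun ψ => by rw [mul_comm]; exact (norm_tensor ψ χ).le)

/-! ### The beam splitter -/

/-- The matrix of the annihilation operator in the Fock basis: `a |n⟩ = √n |n - 1⟩`, so that
`annih m n = ⟨m| a |n⟩`. The matrix of the creation operator is its conjugate transpose. -/
def annih : Matrix ℕ ℕ ℂ := fun m n => if n = m + 1 then (Real.sqrt n : ℂ) else 0

/-- The matrix of `a b† - a† b` in the two-mode Fock basis. -/
def generator : Matrix (ℕ × ℕ) (ℕ × ℕ) ℂ := fun p q =>
  annih p.1 q.1 * annihᴴ p.2 q.2 - annihᴴ p.1 q.1 * annih p.2 q.2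

/-- `a b† - a† b` preserves the total number of photons. -/
theorem generator_eq_zero {p q : ℕ × ℕ} (h : p.1 + p.2 ≠ q.1 + q.2) : generator p q = 0 := by
  have h1 : annih p.1 q.1 * annihᴴ p.2 q.2 = 0 := by
    simp only [annih, Matrix.conjTranspose_apply]
    split_ifs <;> first | omega | simp
  have h2 : annihᴴ p.1 q.1 * annih p.2 q.2 = 0 := by
    simp only [annih, Matrix.conjTranspose_apply]
    split_ifs <;> first | omega | simp
  rw [generator, h1, h2, sub_zero]

/-- The restriction of `a b† - a† b` to the space of states with `N` photons in total, which has
the Fock states `(m, k)` with `m + k = N` as a basis. -/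
def sectorGenerator (N : ℕ) : Matrix (antidiagonal N) (antidiagonal N) ℂ :=
  generator.submatrix Subtype.val Subtype.val

/-- The restriction of `exp (θ (a b† - a† b))` to the space of states with `N` photons in total. -/
def sectorUnitary (θ : ℝ) (N : ℕ) : Matrix (antidiagonal N) (antidiagonal N) ℂ :=
  NormedSpace.exp ((θ : ℂ) • sectorGenerator N)

theorem sectorUnitary_conjTranspose_mul (θ : ℝ) (N : ℕ) :
    (sectorUnitary θ N)ᴴ * sectorUnitary θ N = 1 := by
  have h : ((θ : ℂ) • sectorGenerator N)ᴴ = -((θ : ℂ) • sectorGenerator N) := by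
    ext p q
    simp [sectorGenerator, generator, Matrix.conjTranspose_apply]
    ring
  rw [sectorUnitary, ← Matrix.exp_conjTranspose, h,
    ← Matrix.exp_add_of_commute (-((θ : ℂ) • sectorGenerator N)) _
      (Commute.neg_left (Commute.refl ((θ : ℂ) • sectorGenerator N))), neg_add_cancel,
    NormedSpace.exp_zero]

theorem sum_norm_sectorUnitary (θ : ℝ) (N : ℕ) (v : antidiagonal N → ℂ) :
    ∑ p, ‖(sectorUnitary θ N *ᵥ v) p‖ ^ 2 = ∑ p, ‖v p‖ ^ 2 := by
  have key : ∀ w : antidiagonal N → ℂ, ((∑ p, ‖w p‖ ^ 2 : ℝ) : ℂ) = star w ⬝ᵥ w := fun w => by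
    simp [dotProduct, ← Complex.conj_mul']
  have h : star (sectorUnitary θ N *ᵥ v) ⬝ᵥ (sectorUnitary θ N *ᵥ v) = star v ⬝ᵥ v := by
    rw [Matrix.star_mulVec, Matrix.dotProduct_mulVec, Matrix.vecMul_vecMul,
      sectorUnitary_conjTranspose_mul, Matrix.vecMul_one]
  exact_mod_cast (key _).trans (h.trans (key v).symm)

/-- The amplitudes of `exp (θ (a b† - a† b)) Φ`. -/
def rotate (θ : ℝ) (Φ : ℕ × ℕ → ℂ) (p : ℕ × ℕ) : ℂ :=
  (sectorUnitary θ (p.1 + p.2) *ᵥ fun q => Φ q) ⟨p, mem_antidiagonal.2 rfl⟩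

theorem rotate_apply (θ : ℝ) (Φ : ℕ × ℕ → ℂ) (N : ℕ) (p : antidiagonal N) :
    rotate θ Φ p = (sectorUnitary θ N *ᵥ fun q => Φ q) p := by
  obtain ⟨p, hp⟩ := p
  obtain rfl := mem_antidiagonal.1 hp
  rfl

theorem hasSum_of_sector {f g : ℕ × ℕ → ℝ} {s : ℝ} (hf : HasSum f s) (hg : ∀ p, 0 ≤ g p)
    (h : ∀ N, ∑ p : antidiagonal N, g p.1 = ∑ p : antidiagonal N, f p.1) : HasSum g s := by
  let e : (Σ N : ℕ, antidiagonal N) ≃ ℕ × ℕ := HasAntidiagonal.sigmaAntidiagonalEquivProd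
  have h1 : HasSum (fun N => ∑ p : antidiagonal N, f p.1) s :=
    (e.hasSum_iff.2 hf).sigma fun N => hasSum_fintype _
  have hs : Summable (g ∘ e) := by
    refine (summable_sigma_of_nonneg fun _ => hg _).2
      ⟨fun N => (hasSum_fintype _).summable, ?_⟩
    refine h1.summable.congr fun N => ?_
    rw [tsum_fintype]
    exact (h N).symm
  have h2 : HasSum (fun N => ∑ p : antidiagonal N, g p.1) (∑' x, (g ∘ e) x) :=
    hs.hasSum.sigma fun N => hasSum_fintype _
  simp only [h] at h2
  rw [← h2.unique h1]
  exact e.hasSum_iff.1 hs.hasSum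

theorem hasSum_rotate (θ : ℝ) (Φ : Fock2) :
    HasSum (fun p => ‖rotate θ Φ p‖ ^ 2) (‖Φ‖ ^ 2) := by
  have h1 : HasSum (fun p => ‖Φ p‖ ^ 2) (‖Φ‖ ^ 2) := by
    rw [norm_sq_eq]; exact (summable_sq Φ).hasSum
  refine hasSum_of_sector h1 (fun p => by positivity) fun N => ?_
  simp only [rotate_apply]
  exact sum_norm_sectorUnitary θ N fun q => Φ q

/-- The isometry `exp (θ (a b† - a† b))` of the two-mode state space. -/
def rotation (θ : ℝ) : Fock2 →ₗᵢ[ℂ] Fock2 where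
  toFun Φ := ⟨rotate θ Φ, memℓp_two (hasSum_rotate θ Φ).summable⟩
  map_add' Φ Φ' := by
    ext p
    exact congrFun (Matrix.mulVec_add (sectorUnitary θ (p.1 + p.2)) (fun q => Φ q) fun q => Φ' q)
      ⟨p, mem_antidiagonal.2 rfl⟩
  map_smul' c Φ := by
    ext p
    exact congrFun (Matrix.mulVec_smul (sectorUnitary θ (p.1 + p.2)) c fun q => Φ q)
      ⟨p, mem_antidiagonal.2 rfl⟩
  norm_map' Φ := by
    refine (pow_left_inj₀ (norm_nonneg _) (norm_nonneg _) two_ne_zero).1 ?_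
    rw [norm_sq_eq]
    exact (hasSum_rotate θ Φ).tsum_eq

/-- The beam splitter `B(T) = exp (arccos √T (a b† - a† b))` with transmission probability `T`. -/
def beamSplitter (T : ℝ) : Fock2 →ₗᵢ[ℂ] Fock2 := rotation (Real.arccos (Real.sqrt T))

/-- The state `B(T) (ψ ⊗ |0⟩)` that results from interfering `ψ` with the vacuum. -/
def output (ψ : Fock) (T : ℝ) : Fock2 := beamSplitter T (tensor ψ (ket 0))

/-! ### Reduced states and purity -/

/-- The partial trace over mode `b`: the sum over `k` of `⟨k|_b X |k⟩_b`, convergent in operator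
norm. -/
def partialTrace (X : Fock2 →L[ℂ] Fock2) : Fock →L[ℂ] Fock :=
  ∑' k, (tensorRight (ket k)).adjoint ∘L X ∘L tensorRight (ket k)

/-- The trace, computed in the Fock basis. -/
def trace (A : Fock →L[ℂ] Fock) : ℂ := ∑' n, ⟪ket n, A (ket n)⟫_ℂ

/-- The reduced state of mode `a`: the partial trace over `b` of `|Ψ⟩⟨Ψ|`. -/
def reducedState (Ψ : Fock2) : Fock →L[ℂ] Fock :=
  partialTrace (InnerProductSpace.rankOne ℂ Ψ Ψ)

/-- The purity `Tr ρ²` (a real number for self-adjoint `ρ`). -/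
def purity (ρ : Fock →L[ℂ] Fock) : ℝ := (trace (ρ ∘L ρ)).re

/-- The purity of the reduced state of `B(T) (ψ ⊗ |0⟩)`, as a function of `T`. -/
def outputPurity (ψ : Fock) (T : ℝ) : ℝ := purity (reducedState (output ψ T))

/-- The mixedness (linear entropy) of the reduced state of `B(T) (ψ ⊗ |0⟩)`. -/
def outputMixedness (ψ : Fock) (T : ℝ) : ℝ := 1 - outputPurity ψ T

/-! ### Convergence of the series in the partial trace and in the purity -/

theorem adjoint_tensorRight_ket (k : ℕ) (Ψ : Fock2) (m : ℕ) :
    (tensorRight (ket k)).adjoint Ψ m = Ψ (m, k) := by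
  have h : tensorRight (ket k) (lp.single 2 m (1 : ℂ)) = lp.single 2 (m, k) (1 : ℂ) := by
    ext p
    change (lp.single 2 m (1 : ℂ) : Fock) p.1 * (ket k) p.2 = _
    simp only [ket, lp.single_apply, Pi.single_apply, Prod.ext_iff]
    split_ifs <;> simp_all
  have h1 := ContinuousLinearMap.adjoint_inner_right (tensorRight (ket k))
    (lp.single 2 m (1 : ℂ)) Ψ
  rw [h, lp.inner_single_left, lp.inner_single_left] at h1
  simpa using h1

theorem reducedState_term (Ψ : Fock2) (k : ℕ) :
    (tensorRight (ket k)).adjoint ∘L InnerProductSpace.rankOne ℂ Ψ Ψ ∘L tensorRight (ket k) =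
      InnerProductSpace.rankOne ℂ ((tensorRight (ket k)).adjoint Ψ)
        ((tensorRight (ket k)).adjoint Ψ) := by
  rw [InnerProductSpace.rankOne_comp, InnerProductSpace.comp_rankOne]

theorem hasSum_norm_sq_slice (Ψ : Fock2) :
    HasSum (fun k => ‖(tensorRight (ket k)).adjoint Ψ‖ ^ 2) (‖Ψ‖ ^ 2) := by
  have h1 : HasSum (fun p => ‖Ψ p‖ ^ 2) (‖Ψ‖ ^ 2) := by
    rw [norm_sq_eq]; exact (summable_sq Ψ).hasSum
  rw [← (Equiv.prodComm ℕ ℕ).hasSum_iff] at h1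
  refine h1.prod_fiberwise fun k => ?_
  rw [norm_sq_eq]
  simp only [adjoint_tensorRight_ket]
  exact (h1.summable.prod_factor k).hasSum

/-- The series that defines the reduced state converges in operator norm. -/
theorem hasSum_reducedState (Ψ : Fock2) :
    HasSum (fun k => InnerProductSpace.rankOne ℂ ((tensorRight (ket k)).adjoint Ψ)
      ((tensorRight (ket k)).adjoint Ψ)) (reducedState Ψ) := by
  have hs : Summable fun k => InnerProductSpace.rankOne ℂ ((tensorRight (ket k)).adjoint Ψ)
      ((tensorRight (ket k)).adjoint Ψ) := by
    refine Summable.of_norm ?_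
    simpa [← sq] using (hasSum_norm_sq_slice Ψ).summable
  simpa only [reducedState, partialTrace, reducedState_term] using hs.hasSum

/-- The matrix of the reduced state in the Fock basis. -/
theorem hasSum_reducedState_apply (Ψ : Fock2) (m n : ℕ) :
    HasSum (fun k => Ψ (m, k) * conj (Ψ (n, k))) (reducedState Ψ (ket n) m) := by
  have h := (hasSum_reducedState Ψ).mapL
    ((innerSL ℂ (ket m)) ∘L (ContinuousLinearMap.apply ℂ Fock (ket n)))
  have e : ∀ (f : Fock) (j : ℕ), ⟪ket j, f⟫_ℂ = f j := fun f j => by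
    simp [ket, lp.inner_single_left]
  have e' : ∀ (f : Fock) (j : ℕ), ⟪f, ket j⟫_ℂ = conj (f j) := fun f j => by
    simp [ket, lp.inner_single_right]
  simpa [e, e', adjoint_tensorRight_ket, mul_comm] using h

theorem isSelfAdjoint_reducedState (Ψ : Fock2) : IsSelfAdjoint (reducedState Ψ) := by
  have h := (hasSum_reducedState Ψ).star
  refine h.unique ?_
  convert hasSum_reducedState Ψ using 2 with k
  rw [ContinuousLinearMap.star_eq_adjoint, InnerProductSpace.adjoint_rankOne]

/-- The series that defines the purity of the reduced state converges. -/
theorem summable_purity (Ψ : Fock2) :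
    Summable fun n => ⟪ket n, (reducedState Ψ ∘L reducedState Ψ) (ket n)⟫_ℂ := by
  have hΨ : Summable fun p => ‖Ψ p‖ ^ 2 := summable_sq Ψ
  have hslice := hasSum_norm_sq_slice Ψ
  have key : ∀ n, ‖reducedState Ψ (ket n)‖ ^ 2 ≤ (∑' k, ‖Ψ (n, k)‖ ^ 2) * ‖Ψ‖ ^ 2 := by
    intro n
    have hrow : Summable fun k => ‖Ψ (n, k)‖ ^ 2 := hΨ.prod_factor n
    have h1 := (hasSum_reducedState Ψ).mapL (ContinuousLinearMap.apply ℂ Fock (ket n))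
    have e' : ∀ f : Fock, ⟪f, ket n⟫_ℂ = conj (f n) := fun f => by
      simp [ket, lp.inner_single_right]
    simp only [ContinuousLinearMap.apply_apply, InnerProductSpace.rankOne_apply, e',
      adjoint_tensorRight_ket] at h1
    have hcs := Real.summable_and_inner_le_Lp_mul_Lq_tsum_of_nonneg (Real.HolderConjugate.two_two)
      (f := fun k => ‖Ψ (n, k)‖) (g := fun k => ‖(tensorRight (ket k)).adjoint Ψ‖)
      (fun _ => norm_nonneg _) (fun _ => norm_nonneg _)
      (by simpa using hrow) (by simpa using hslice.summable)
    have h2 : ‖reducedState Ψ (ket n)‖ ≤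
        ∑' k, ‖Ψ (n, k)‖ * ‖(tensorRight (ket k)).adjoint Ψ‖ := by
      rw [← h1.tsum_eq]
      refine tsum_of_norm_bounded hcs.1.hasSum fun k => ?_
      rw [norm_smul, RCLike.norm_conj]
    have h3 := h2.trans hcs.2
    simp only [Real.rpow_two, hslice.tsum_eq, ← Real.sqrt_eq_rpow] at h3
    calc _ ≤ _ := pow_le_pow_left₀ (norm_nonneg _) h3 2
      _ = _ := by
        rw [mul_pow, Real.sq_sqrt (tsum_nonneg fun _ => by positivity),
          Real.sq_sqrt (by positivity)]
  have hs : Summable fun n => (∑' k, ‖Ψ (n, k)‖ ^ 2) * ‖Ψ‖ ^ 2 := hΨ.prod.mul_right _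
  refine Summable.of_norm_bounded hs fun n => ?_
  have h4 : ⟪ket n, (reducedState Ψ ∘L reducedState Ψ) (ket n)⟫_ℂ =
      ⟪reducedState Ψ (ket n), reducedState Ψ (ket n)⟫_ℂ := by
    rw [ContinuousLinearMap.comp_apply, ← ContinuousLinearMap.adjoint_inner_left,
      ContinuousLinearMap.isSelfAdjoint_iff'.1 (isSelfAdjoint_reducedState Ψ)]
  rw [h4, inner_self_eq_norm_sq_to_K, norm_pow, RCLike.norm_ofReal, abs_norm]
  exact key n

end BeamSplitter

end

noncomputable section

namespace BeamSplitter

open Finset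
open scoped Matrix ComplexConjugate InnerProductSpace Nat TensorProduct Polynomial

/-! ### Amplitudes of the output state -/

/-! The beam splitter sends `|N, 0⟩` to a binomial superposition of the `|m, k⟩` with `m + k = N`.
The binomial amplitudes and `exp (θ G)` applied to `|N, 0⟩`, with `G` the generator, solve the same
linear equation (`eq_exp_smul_mulVec`), which yields `output_apply`.

The purity is the sum of `|ρ_{mn}|²`, hence an absolutely convergent series over quadruples of
photon numbers. Grouped by the total `N`, each group is a finite sum (`puritySector`). The heart of
the proof is to read this sum as `L ⊗ conj L` applied to the `N`-th power of `T (1 ⊗ X + X ⊗ 1) + (1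
- T) (X ⊗ X + 1 ⊗ 1)`, divided by `N!`. This element is diagonal in `X + 1`, `X - 1`, with
coefficients `1/2` and `(1 - 2T)/2`. Expanding the power gives a polynomial in `1 - 2T` whose
coefficients are positive multiples of some `|L p|²`, hence nonnegative (`puritySector_eq_sum`).

Invariance under `T ↦ 1 - T` removes the odd powers. Even powers of `1 - 2T` are convex and minimal
at `T = 1/2`, and both properties pass to the sum over `N`. -/

/-- The amplitude of `|m, k⟩` in `exp (θ (a b† - a† b)) |m + k, 0⟩`. -/
def binomialAmplitude (θ : ℝ) (m k : ℕ) : ℝ :=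
  √((m + k)! : ℝ) / (√(m ! : ℝ) * √(k ! : ℝ)) * (Real.cos θ ^ m * Real.sin θ ^ k)

theorem sqrt_factorial_succ (n : ℕ) : √((n + 1)! : ℝ) = √((n + 1 : ℕ) : ℝ) * √(n ! : ℝ) := by
  rw [Nat.factorial_succ, Nat.cast_mul, Real.sqrt_mul (Nat.cast_nonneg _)]

theorem sqrt_factorial_pos (n : ℕ) : 0 < √(n ! : ℝ) :=
  Real.sqrt_pos.2 (Nat.cast_pos.2 n.factorial_pos)

/-- The coefficients are the matrix entries of `a b† - a† b`, so this is the equation `v' = G v` in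
coordinates. The truncated `k - 1` and `m - 1` are harmless: at `0` they come with the factor `√0`.
-/
theorem hasDerivAt_binomialAmplitude (θ : ℝ) (m k : ℕ) :
    HasDerivAt (fun θ => binomialAmplitude θ m k)
      (√((m + 1 : ℕ) : ℝ) * √(k : ℝ) * binomialAmplitude θ (m + 1) (k - 1) -
        √(m : ℝ) * √((k + 1 : ℕ) : ℝ) * binomialAmplitude θ (m - 1) (k + 1)) θ := by
  have h := (((Real.hasDerivAt_cos θ).pow m).mul ((Real.hasDerivAt_sin θ).pow k)).const_mul
    (√((m + k)! : ℝ) / (√(m ! : ℝ) * √(k ! : ℝ)))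
  refine h.congr_deriv ?_
  have hup : √((m + 1 : ℕ) : ℝ) * √(k : ℝ) * binomialAmplitude θ (m + 1) (k - 1) =
      √((m + k)! : ℝ) / (√(m ! : ℝ) * √(k ! : ℝ)) *
        (Real.cos θ ^ m * (k * Real.sin θ ^ (k - 1) * Real.cos θ)) := by
    rcases k with _ | k
    · simp
    · have h1 : √((m + 1 : ℕ) : ℝ) ≠ 0 := by positivity
      have h2 : √((k + 1 : ℕ) : ℝ) ≠ 0 := by positivity
      have h3 := (sqrt_factorial_pos m).ne'
      have h4 := (sqrt_factorial_pos k).ne'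
      have h5 : (((k + 1 : ℕ) : ℝ)) = √((k + 1 : ℕ) : ℝ) ^ 2 :=
        (Real.sq_sqrt (Nat.cast_nonneg _)).symm
      rw [binomialAmplitude, Nat.add_sub_cancel, sqrt_factorial_succ m, sqrt_factorial_succ k,
        show m + 1 + k = m + (k + 1) by ring]
      generalize √((m + (k + 1))! : ℝ) = z at *
      generalize hx : √((k + 1 : ℕ) : ℝ) = x at *
      rw [h5]
      field_simp
      ring
  have hdown : √(m : ℝ) * √((k + 1 : ℕ) : ℝ) * binomialAmplitude θ (m - 1) (k + 1) =
      √((m + k)! : ℝ) / (√(m ! : ℝ) * √(k ! : ℝ)) *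
        (m * Real.cos θ ^ (m - 1) * Real.sin θ * Real.sin θ ^ k) := by
    rcases m with _ | m
    · simp
    · have h1 : √((k + 1 : ℕ) : ℝ) ≠ 0 := by positivity
      have h2 : √((m + 1 : ℕ) : ℝ) ≠ 0 := by positivity
      have h3 := (sqrt_factorial_pos m).ne'
      have h4 := (sqrt_factorial_pos k).ne'
      have h5 : (((m + 1 : ℕ) : ℝ)) = √((m + 1 : ℕ) : ℝ) ^ 2 :=
        (Real.sq_sqrt (Nat.cast_nonneg _)).symm
      rw [binomialAmplitude, Nat.add_sub_cancel, sqrt_factorial_succ m, sqrt_factorial_succ k,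
        show m + 1 + k = m + (k + 1) by ring]
      generalize √((m + (k + 1))! : ℝ) = z at *
      generalize hx : √((m + 1 : ℕ) : ℝ) = x at *
      rw [h5]
      field_simp
      ring
  rw [hup, hdown]
  simp only [Pi.pow_apply]
  ring

/-- The vector of the amplitudes `binomialAmplitude` in the space of `N` photons. -/
def binomialVector (N : ℕ) (θ : ℝ) : antidiagonal N → ℂ :=
  fun p => binomialAmplitude θ p.1.1 p.1.2

/-- Each row of the generator has at most two nonzero entries. Taking `f` on all of `ℕ × ℕ` lets the
formula hold at the boundary too, where the neighbour leaves the sector but has coefficient zero. -/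
theorem sectorGenerator_mulVec (N : ℕ) (f : ℕ × ℕ → ℂ) (p : antidiagonal N) :
    (sectorGenerator N *ᵥ fun q => f q) p =
      (√((p.1.1 + 1 : ℕ) : ℝ) * √(p.1.2 : ℝ) : ℂ) * f (p.1.1 + 1, p.1.2 - 1) -
        (√(p.1.1 : ℝ) * √((p.1.2 + 1 : ℕ) : ℝ) : ℂ) * f (p.1.1 - 1, p.1.2 + 1) := by
  obtain ⟨⟨m, k⟩, hp⟩ := p
  have hN : m + k = N := mem_antidiagonal.1 hp
  have h := Finset.sum_coe_sort (antidiagonal N) fun q => generator (m, k) q * f q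
  simp only [Matrix.mulVec, dotProduct, sectorGenerator, Matrix.submatrix_apply]
  rw [h]
  simp only [generator, sub_mul, Finset.sum_sub_distrib]
  congr 1
  · rcases k with _ | k
    · simp only [Nat.cast_zero, Real.sqrt_zero, Complex.ofReal_zero, mul_zero, zero_mul]
      refine Finset.sum_eq_zero fun q _ => ?_
      simp [annih, Matrix.conjTranspose_apply]
    · rw [Finset.sum_eq_single (m + 1, k)]
      · simp [annih, Matrix.conjTranspose_apply]
      · rintro ⟨a, b⟩ hq hne
        have hq' : a + b = N := mem_antidiagonal.1 hq
        have : a ≠ m + 1 := by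
          rintro rfl
          exact hne (by ext <;> simp; omega)
        simp [annih, this]
      · intro hq
        exact absurd (HasAntidiagonal.mem_antidiagonal.2 (by simp; omega)) hq
  · rcases m with _ | m
    · simp only [Nat.cast_zero, Real.sqrt_zero, Complex.ofReal_zero, zero_mul]
      refine Finset.sum_eq_zero fun q _ => ?_
      simp [annih, Matrix.conjTranspose_apply]
    · rw [Finset.sum_eq_single (m, k + 1)]
      · simp [annih, Matrix.conjTranspose_apply]
      · rintro ⟨a, b⟩ hq hne
        have hq' : a + b = N := mem_antidiagonal.1 hq
        have : b ≠ k + 1 := by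
          rintro rfl
          exact hne (by ext <;> simp; omega)
        simp [annih, this]
      · intro hq
        exact absurd (HasAntidiagonal.mem_antidiagonal.2 (by simp; omega)) hq

theorem hasDerivAt_binomialVector (N : ℕ) (θ : ℝ) :
    HasDerivAt (binomialVector N) (sectorGenerator N *ᵥ binomialVector N θ) θ := by
  refine hasDerivAt_pi.2 fun p => ?_
  have h := (hasDerivAt_binomialAmplitude θ p.1.1 p.1.2).ofReal_comp
  refine h.congr_deriv ?_
  have := sectorGenerator_mulVec N (fun q => (binomialAmplitude θ q.1 q.2 : ℂ)) p
  rw [show binomialVector N θ = fun q => (binomialAmplitude θ q.1.1 q.1.2 : ℂ) from rfl, this]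
  push_cast
  ring

section
attribute [local instance] Matrix.linftyOpNormedRing Matrix.linftyOpNormedAlgebra

/-- Solutions of the linear equation `v' = A v` are given by the matrix exponential. -/
theorem eq_exp_smul_mulVec {n : Type*} [Fintype n] [DecidableEq n] (A : Matrix n n ℂ)
    {v : ℝ → n → ℂ} (hv : ∀ θ, HasDerivAt v (A *ᵥ v θ) θ) (θ : ℝ) :
    v θ = NormedSpace.exp ((θ : ℂ) • A) *ᵥ v 0 := by
  -- The integrating factor: `exp (-tA) v(t)` has derivative zero, hence is constant.
  have hexp : ∀ t : ℝ, HasDerivAt (fun t : ℝ => NormedSpace.exp (t • (-A)))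
      (NormedSpace.exp (t • (-A)) * (-A)) t := fun t => hasDerivAt_exp_smul_const (-A) t
  have hcoord : ∀ t : ℝ, HasDerivAt (fun t : ℝ => NormedSpace.exp (t • (-A)) *ᵥ v t) 0 t := by
    intro t
    refine hasDerivAt_pi.2 fun i => ?_
    have hentry : ∀ j, HasDerivAt (fun t : ℝ => NormedSpace.exp (t • (-A)) i j)
        ((NormedSpace.exp (t • (-A)) * (-A)) i j) t := fun j =>
      hasDerivAt_pi.1 (hasDerivAt_pi.1 (hexp t) i) j
    have hsum := HasDerivAt.fun_sum (u := Finset.univ) fun j _ =>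
      (hentry j).mul (hasDerivAt_pi.1 (hv t) j)
    refine hsum.congr_deriv ?_
    rw [Finset.sum_add_distrib]
    change ((NormedSpace.exp (t • (-A)) * (-A)) *ᵥ v t + NormedSpace.exp (t • (-A)) *ᵥ (A *ᵥ v t)) i
      = 0
    rw [Matrix.mulVec_mulVec, ← Matrix.add_mulVec, ← mul_add, neg_add_cancel, mul_zero,
      Matrix.zero_mulVec, Pi.zero_apply]
  have hconst := is_const_of_deriv_eq_zero (fun t => (hcoord t).differentiableAt)
    (fun t => (hcoord t).deriv) θ 0
  simp only [zero_smul, NormedSpace.exp_zero, Matrix.one_mulVec] at hconst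
  rw [← hconst, Matrix.mulVec_mulVec, smul_neg, show (θ : ℂ) • A = θ • A from rfl,
    ← Matrix.exp_add_of_commute _ _ (Commute.neg_right (Commute.refl (θ • A))), add_neg_cancel,
    NormedSpace.exp_zero, Matrix.one_mulVec]

end

theorem binomialAmplitude_zero (m k : ℕ) :
    binomialAmplitude 0 m k = if k = 0 then 1 else 0 := by
  rcases k with _ | k
  · have := (sqrt_factorial_pos m).ne'
    simp [binomialAmplitude, this]
  · simp [binomialAmplitude]

theorem rotate_tensor_vacuum (θ : ℝ) (ψ : Fock) (m k : ℕ) :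
    rotate θ (tensor ψ (ket 0)) (m, k) = ψ (m + k) * binomialAmplitude θ m k := by
  -- At `θ = 0` the binomial vector is the Fock state `|m + k, 0⟩`, so the input restricted to the
  -- sector is a multiple of the initial value.
  have hin : (fun q : antidiagonal (m + k) => tensor ψ (ket 0) q) =
      ψ (m + k) • binomialVector (m + k) 0 := by
    ext ⟨⟨a, b⟩, hq⟩
    have hq' : a + b = m + k := mem_antidiagonal.1 hq
    change ψ a * (lp.single 2 0 (1 : ℂ) : Fock) b = ψ (m + k) * (binomialAmplitude 0 a b : ℂ)
    rw [binomialAmplitude_zero, lp.single_apply, Pi.single_apply]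
    split_ifs with hb
    · subst hb
      rw [← hq', add_zero, Complex.ofReal_one]
    · simp
  rw [rotate, hin, Matrix.mulVec_smul, sectorUnitary,
    ← eq_exp_smul_mulVec _ (hasDerivAt_binomialVector (m + k)) θ]
  rfl

theorem output_apply (ψ : Fock) {T : ℝ} (hT : T ∈ Set.Icc (0 : ℝ) 1) (m k : ℕ) :
    output ψ T (m, k) = ψ (m + k) *
      ((√((m + k)! : ℝ) / (√(m ! : ℝ) * √(k ! : ℝ)) * (√T ^ m * √(1 - T) ^ k) : ℝ) : ℂ) := by
  have h := rotate_tensor_vacuum (Real.arccos √T) ψ m k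
  rw [binomialAmplitude, Real.cos_arccos (by linarith [Real.sqrt_nonneg T])
    (Real.sqrt_le_one.2 hT.2), Real.sin_arccos, Real.sq_sqrt hT.1] at h
  exact h

/-! ### The purity as a series -/

theorem summable_mul_cross {g : ℕ × ℕ → ℝ} (hg : Summable g) (h0 : ∀ p, 0 ≤ g p) :
    (Summable fun x : (ℕ × ℕ) × (ℕ × ℕ) => g (x.1.1, x.2.1) * g (x.1.2, x.2.2)) ∧
      Summable fun x : (ℕ × ℕ) × (ℕ × ℕ) => g (x.1.2, x.2.1) * g (x.1.1, x.2.2) := by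
  have hs : Summable fun x : (ℕ × ℕ) × (ℕ × ℕ) => g x.1 * g x.2 := hg.mul_of_nonneg hg h0 h0
  have h1 : Summable fun x : (ℕ × ℕ) × (ℕ × ℕ) => g (x.1.1, x.2.1) * g (x.1.2, x.2.2) :=
    (Equiv.prodProdProdComm ℕ ℕ ℕ ℕ).summable_iff.2 hs
  exact ⟨h1, ((Equiv.prodComm ℕ ℕ).prodCongr (Equiv.refl (ℕ × ℕ))).summable_iff.2 h1⟩

/-- Absolute convergence over all four indices is what permits regrouping the purity by total photon
number. -/
theorem summable_quadruple {f : ℕ × ℕ → ℂ} (hf : Summable fun p => ‖f p‖ ^ 2) :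
    Summable fun x : (ℕ × ℕ) × (ℕ × ℕ) => f (x.1.2, x.2.1) * conj (f (x.1.1, x.2.1)) *
      conj (f (x.1.2, x.2.2) * conj (f (x.1.1, x.2.2))) := by
  obtain ⟨h1, h2⟩ := summable_mul_cross hf fun p => sq_nonneg ‖f p‖
  -- The four amplitudes are paired so that the two in a pair share no index; each dominating series
  -- then factors into a product of two norm sums.
  have hle : ∀ a b c d : ℝ, c * a * (b * d) ≤ a ^ 2 * b ^ 2 + c ^ 2 * d ^ 2 := fun a b c d => by
    nlinarith [sq_nonneg (a * b - c * d), sq_nonneg (a * b), sq_nonneg (c * d)]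
  refine Summable.of_norm_bounded (h1.add h2) fun x => ?_
  rw [norm_mul, norm_mul, RCLike.norm_conj, RCLike.norm_conj, norm_mul, RCLike.norm_conj]
  exact hle _ _ _ _

/-- Self-adjointness of `ρ` gives `Tr ρ² = ∑ |ρ_{mn}|²`, and each entry is itself a sum over the
photon number of mode `b`, so its squared modulus is a double sum. -/
theorem hasSum_purity_quadruple (Ψ : Fock2) :
    HasSum (fun x : (ℕ × ℕ) × (ℕ × ℕ) => Ψ (x.1.2, x.2.1) * conj (Ψ (x.1.1, x.2.1)) *
      conj (Ψ (x.1.2, x.2.2) * conj (Ψ (x.1.1, x.2.2)))) (purity (reducedState Ψ) : ℂ) := by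
  have hs := summable_quadruple (summable_sq Ψ)
  have hinner : ∀ x : ℕ × ℕ, ∑' y : ℕ × ℕ, Ψ (x.2, y.1) * conj (Ψ (x.1, y.1)) *
      conj (Ψ (x.2, y.2) * conj (Ψ (x.1, y.2))) =
        ((‖reducedState Ψ (ket x.1) x.2‖ ^ 2 : ℝ) : ℂ) := by
    intro x
    have h := hasSum_reducedState_apply Ψ x.2 x.1
    have h' := h.mul h.star (hs.prod_factor x)
    refine h'.tsum_eq.trans ?_
    rw [Complex.star_def, Complex.mul_conj, Complex.normSq_eq_norm_sq]
  have hprod := hs.hasSum.prod_fiberwise fun x => (hs.prod_factor x).hasSum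
  simp only [hinner] at hprod
  have hsq : Summable fun x : ℕ × ℕ => ‖reducedState Ψ (ket x.1) x.2‖ ^ 2 :=
    Complex.summable_ofReal.1 hprod.summable
  have hdiag : ∀ n, ⟪ket n, (reducedState Ψ ∘L reducedState Ψ) (ket n)⟫_ℂ =
      ((∑' m, ‖reducedState Ψ (ket n) m‖ ^ 2 : ℝ) : ℂ) := by
    intro n
    rw [ContinuousLinearMap.comp_apply, ← ContinuousLinearMap.adjoint_inner_left,
      ContinuousLinearMap.isSelfAdjoint_iff'.1 (isSelfAdjoint_reducedState Ψ),
      inner_self_eq_norm_sq_to_K, ← norm_sq_eq]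
    simp
  have htrace : trace (reducedState Ψ ∘L reducedState Ψ) =
      ((∑' x : ℕ × ℕ, ‖reducedState Ψ (ket x.1) x.2‖ ^ 2 : ℝ) : ℂ) := by
    rw [trace, hsq.tsum_prod, Complex.ofReal_tsum]
    exact tsum_congr hdiag
  rw [purity, htrace, Complex.ofReal_re, Complex.ofReal_tsum, hprod.tsum_eq]
  exact hs.hasSum

theorem _root_.HasSum.sum_fiberwise {α β γ : Type*} [AddCommGroup α] [UniformSpace α]
    [IsUniformAddGroup α] [CompleteSpace α] [T2Space α] {f : β → α} {a : α} (hf : HasSum f a)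
    (g : β → γ) (t : γ → Finset β) (ht : ∀ b c, b ∈ t c ↔ g b = c) :
    HasSum (fun c => ∑ b ∈ t c, f b) a := by
  convert hf.tsum_fiberwise g using 2 with c
  rw [← Finset.tsum_subtype', show g ⁻¹' {c} = (t c : Set β) from Set.ext fun b => (ht b c).symm]

/-- The weight of the quadruple of photon numbers `((m, n), (k, l))` in the purity at
transmission probability `T`. -/
def purityTerm (f : ℕ → ℂ) (T : ℝ) (x : (ℕ × ℕ) × (ℕ × ℕ)) : ℂ :=
  f (x.1.2 + x.2.1) * f (x.1.1 + x.2.2) * conj (f (x.1.1 + x.2.1) * f (x.1.2 + x.2.2)) *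
    ((T ^ (x.1.1 + x.1.2) * (1 - T) ^ (x.2.1 + x.2.2) /
      ((x.1.1)! * (x.1.2)! * ((x.2.1)! * (x.2.2)!)) : ℝ) : ℂ)

/-- The contribution to the purity of the quadruples with `N` photons in total. -/
def puritySector (f : ℕ → ℂ) (T : ℝ) (N : ℕ) : ℂ :=
  ∑ s ∈ antidiagonal N, ∑ x ∈ antidiagonal s.1 ×ˢ antidiagonal s.2, purityTerm f T x

/-- The rescaling `f n = ψ n √n!` absorbs the factors `√(m + k)!` of the amplitudes. -/
theorem hasSum_puritySector (ψ : Fock) {T : ℝ} (hT : T ∈ Set.Icc (0 : ℝ) 1) :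
    HasSum (puritySector (fun n => ψ n * (√(n ! : ℝ) : ℂ)) T) (outputPurity ψ T : ℂ) := by
  have h : HasSum (purityTerm (fun n => ψ n * (√(n ! : ℝ) : ℂ)) T) (outputPurity ψ T : ℂ) := by
    rw [outputPurity]
    convert hasSum_purity_quadruple (output ψ T) using 2 with x
    obtain ⟨⟨n, m⟩, ⟨k, l⟩⟩ := x
    simp only [output_apply ψ hT, purityTerm, map_mul, Complex.conj_conj, Complex.conj_ofReal]
    -- Each of `n, m, k, l` occurs in exactly two of the four amplitudes, so all square roots pair
    -- off.
    have hre : (T ^ (n + m) * (1 - T) ^ (k + l) / (n ! * m ! * (k ! * l !)) : ℝ) =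
        (√T ^ m * √(1 - T) ^ k) * (√T ^ n * √(1 - T) ^ k) * (√T ^ m * √(1 - T) ^ l) *
          (√T ^ n * √(1 - T) ^ l) / ((√(m ! : ℝ) * √(k ! : ℝ)) * (√(n ! : ℝ) * √(k ! : ℝ)) *
            (√(m ! : ℝ) * √(l ! : ℝ)) * (√(n ! : ℝ) * √(l ! : ℝ))) := by
      have e : ∀ j : ℕ, (j ! : ℝ) = √(j ! : ℝ) ^ 2 := fun j =>
        (Real.sq_sqrt (Nat.cast_nonneg _)).symm
      have e1 : T = √T ^ 2 := (Real.sq_sqrt hT.1).symm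
      have e2 : 1 - T = √(1 - T) ^ 2 := (Real.sq_sqrt (by linarith [hT.2])).symm
      generalize √(1 - T) = r at *
      generalize √T = t at *
      rw [e n, e m, e k, e l, e2, e1]
      simp only [Real.sqrt_sq (Real.sqrt_nonneg _)]
      congr 1 <;> ring
    rw [hre]
    push_cast
    ring
  have h1 := h.sum_fiberwise (fun x => (x.1.1 + x.1.2, x.2.1 + x.2.2))
    (fun s => antidiagonal s.1 ×ˢ antidiagonal s.2) fun b c => by
      simp [Prod.ext_iff]
  exact h1.sum_fiberwise (fun s => s.1 + s.2) antidiagonal fun b c => mem_antidiagonal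

/-- Exchanging the photon numbers of modes `a` and `b` permutes the four factors `f`. Physically,
the two reduced states of a pure state have equal purity. -/
theorem puritySector_one_sub (f : ℕ → ℂ) (T : ℝ) (N : ℕ) :
    puritySector f (1 - T) N = puritySector f T N := by
  unfold puritySector
  rw [← Finset.Nat.sum_antidiagonal_swap]
  refine Finset.sum_congr rfl fun s _ => ?_
  simp only [Prod.fst_swap, Prod.snd_swap]
  rw [Finset.sum_product, Finset.sum_product_right]
  refine Finset.sum_congr rfl fun x _ => Finset.sum_congr rfl fun y _ => ?_
  simp only [purityTerm, sub_sub_cancel]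
  rw [add_comm y.1 x.1, add_comm y.2 x.2, add_comm y.1 x.2, add_comm y.2 x.1]
  push_cast
  simp only [map_mul]
  ring

/-! ### Diagonalization of the series in powers of `1 - 2T` -/

theorem inv_factorial_smul_add_pow {A : Type*} [CommRing A] [Algebra ℝ A] (a b : A) (n : ℕ) :
    ((n ! : ℝ)⁻¹) • (a + b) ^ n =
      ∑ p ∈ antidiagonal n, ((p.1 ! : ℝ) * (p.2 ! : ℝ))⁻¹ • (a ^ p.1 * b ^ p.2) := by
  rw [(Commute.all a b).add_pow', Finset.smul_sum]
  refine Finset.sum_congr rfl fun p hp => ?_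
  obtain rfl := mem_antidiagonal.1 hp
  rw [← Nat.cast_smul_eq_nsmul ℝ, smul_smul]
  congr 1
  rw [Nat.choose_symm_add]
  have h := Nat.add_choose_mul_factorial_mul_factorial p.1 p.2
  have h' : (((p.1 + p.2).choose p.2 : ℝ)) * (p.1)! * (p.2)! = (p.1 + p.2)! := by
    exact_mod_cast h
  have := (p.1).factorial_ne_zero
  have := (p.2).factorial_ne_zero
  rw [← h']
  have h0 : ((p.1 + p.2).choose p.2 : ℝ) ≠ 0 := by
    exact_mod_cast (Nat.choose_pos (Nat.le_add_left _ _)).ne'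
  field_simp

/-- The real-linear functional on polynomials with `X ^ n ↦ u n`. -/
def coeffFunctional (u : ℕ → ℂ) : ℝ[X] →ₗ[ℝ] ℂ := (Polynomial.basisMonomials ℝ).constr ℝ u

theorem coeffFunctional_X_pow (u : ℕ → ℂ) (n : ℕ) :
    coeffFunctional u (Polynomial.X ^ n) = u n := by
  have := (Polynomial.basisMonomials ℝ).constr_basis ℝ u n
  simp only [Polynomial.coe_basisMonomials] at this
  rwa [Polynomial.monomial_one_right_eq_X_pow] at this

/-- The functional `p ⊗ q ↦ L p * conj (L q)`, where `L = coeffFunctional u`. -/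
def sesqFunctional (u : ℕ → ℂ) : ℝ[X] ⊗[ℝ] ℝ[X] →ₗ[ℝ] ℂ :=
  LinearMap.mul' ℝ ℂ ∘ₗ TensorProduct.map (coeffFunctional u)
    (Complex.conjAe.toLinearMap ∘ₗ coeffFunctional u)

theorem sesqFunctional_tmul (u : ℕ → ℂ) (p q : ℝ[X]) :
    sesqFunctional u (p ⊗ₜ q) = coeffFunctional u p * conj (coeffFunctional u q) := rfl

-- Choosing `1 ⊗ X`, `X ⊗ 1`, `X ⊗ X`, `1 ⊗ 1` respectively `n, m, k, l` times produces `X ^ (m + k)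
-- ⊗ X ^ (n + k)` with weight `1 / (n! m! k! l!)`. Since `N - (m + k) = n + l` and `N - (n + k) = m
-- + l`, the functional with `u j = f j * f (N - j)` restores all four factors.
open Polynomial (X) in
theorem puritySector_eq_sesqFunctional (f : ℕ → ℂ) (T : ℝ) (N : ℕ) :
    puritySector f T N = sesqFunctional (fun n => f n * f (N - n)) (((N ! : ℝ)⁻¹) •
      (T • ((1 : ℝ[X]) ⊗ₜ[ℝ] (X : ℝ[X]) + (X : ℝ[X]) ⊗ₜ[ℝ] (1 : ℝ[X])) +
        (1 - T) • ((X : ℝ[X]) ⊗ₜ[ℝ] (X : ℝ[X]) + (1 : ℝ[X]) ⊗ₜ[ℝ] (1 : ℝ[X]))) ^ N) := by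
  rw [inv_factorial_smul_add_pow, map_sum, puritySector]
  refine Finset.sum_congr rfl fun s hs => ?_
  have hsplit : ((s.1 ! : ℝ) * (s.2 ! : ℝ))⁻¹ •
      ((T • ((1 : ℝ[X]) ⊗ₜ[ℝ] (X : ℝ[X]) + (X : ℝ[X]) ⊗ₜ[ℝ] (1 : ℝ[X]))) ^ s.1 *
        ((1 - T) • ((X : ℝ[X]) ⊗ₜ[ℝ] (X : ℝ[X]) + (1 : ℝ[X]) ⊗ₜ[ℝ] (1 : ℝ[X]))) ^ s.2) =
      (T ^ s.1 * (1 - T) ^ s.2) •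
        (((s.1 ! : ℝ)⁻¹ • ((1 : ℝ[X]) ⊗ₜ[ℝ] (X : ℝ[X]) + (X : ℝ[X]) ⊗ₜ[ℝ] (1 : ℝ[X])) ^ s.1) *
        ((s.2 ! : ℝ)⁻¹ • ((X : ℝ[X]) ⊗ₜ[ℝ] (X : ℝ[X]) + (1 : ℝ[X]) ⊗ₜ[ℝ] (1 : ℝ[X])) ^ s.2)) := by
    simp only [smul_pow, smul_mul_assoc, mul_smul_comm, smul_smul]
    congr 1
    rw [mul_inv]
    ring
  rw [hsplit, inv_factorial_smul_add_pow, inv_factorial_smul_add_pow, Finset.sum_mul_sum,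
    ← Finset.sum_product', Finset.smul_sum, map_sum]
  refine Finset.sum_congr rfl fun x hx => ?_
  obtain ⟨⟨n, m⟩, ⟨k, l⟩⟩ := x
  obtain ⟨S, R⟩ := s
  simp only [mem_product, HasAntidiagonal.mem_antidiagonal] at hx hs
  obtain ⟨rfl, rfl⟩ := hx
  simp only [Algebra.TensorProduct.tmul_pow, smul_mul_smul_comm, one_pow,
    Algebra.TensorProduct.tmul_mul_tmul, one_mul, mul_one, ← pow_add, map_smul,
    sesqFunctional_tmul, coeffFunctional_X_pow, purityTerm]
  rw [show N - (m + k) = n + l by omega, show N - (n + k) = m + l by omega, smul_smul,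
    Complex.real_smul]
  push_cast
  rw [mul_comm]
  congr 1
  rw [← mul_inv, div_eq_mul_inv]

open Polynomial (X) in
/-- The squared amplitude, up to normalization, of `(N - j, j)` photons after two copies of the
input interfere on a balanced beam splitter. -/
def interferenceWeight (f : ℕ → ℂ) (N : ℕ) (s : ℕ × ℕ) : ℝ :=
  ((s.1 ! : ℝ) * (s.2 ! : ℝ))⁻¹ * ((1 / 2) ^ N *
    ‖coeffFunctional (fun n => f n * f (N - n)) ((X + 1) ^ s.1 * (X - 1) ^ s.2)‖ ^ 2)

theorem interferenceWeight_nonneg (f : ℕ → ℂ) (N : ℕ) (s : ℕ × ℕ) :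
    0 ≤ interferenceWeight f N s := by
  unfold interferenceWeight
  positivity

open Polynomial (X) in
theorem puritySector_eq_sum (f : ℕ → ℂ) (T : ℝ) (N : ℕ) :
    puritySector f T N =
      ((∑ s ∈ antidiagonal N, interferenceWeight f N s * (1 - 2 * T) ^ s.2 : ℝ) : ℂ) := by
  -- The symmetric form with diagonal entries `1 - T` and off-diagonal entries `T` has eigenvectors
  -- `X + 1` and `X - 1`, with eigenvalues `1` and `1 - 2T`; the factor `1/2` normalizes them.
  have hbase : T • ((1 : ℝ[X]) ⊗ₜ[ℝ] (X : ℝ[X]) + (X : ℝ[X]) ⊗ₜ[ℝ] (1 : ℝ[X])) +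
        (1 - T) • ((X : ℝ[X]) ⊗ₜ[ℝ] (X : ℝ[X]) + (1 : ℝ[X]) ⊗ₜ[ℝ] (1 : ℝ[X])) =
      (1 / 2 : ℝ) • ((X + 1 : ℝ[X]) ⊗ₜ[ℝ] (X + 1 : ℝ[X])) +
        ((1 / 2 : ℝ) * (1 - 2 * T)) • ((X - 1 : ℝ[X]) ⊗ₜ[ℝ] (X - 1 : ℝ[X])) := by
    simp only [TensorProduct.add_tmul, TensorProduct.tmul_add, TensorProduct.sub_tmul,
      TensorProduct.tmul_sub]
    module
  rw [puritySector_eq_sesqFunctional, hbase, inv_factorial_smul_add_pow, map_sum,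
    Complex.ofReal_sum]
  refine Finset.sum_congr rfl fun s hs => ?_
  obtain rfl := mem_antidiagonal.1 hs
  simp only [smul_pow, Algebra.TensorProduct.tmul_pow, smul_mul_smul_comm,
    Algebra.TensorProduct.tmul_mul_tmul, map_smul, sesqFunctional_tmul, interferenceWeight]
  rw [Complex.mul_conj, Complex.normSq_eq_norm_sq, Complex.real_smul, Complex.real_smul,
    ← Complex.ofReal_mul, ← Complex.ofReal_mul]
  congr 1
  rw [mul_pow, pow_add]
  ring

/-- The even part of the expansion of the sector contribution in powers of `1 - 2T`. -/
def sectorPurity (f : ℕ → ℂ) (N : ℕ) (T : ℝ) : ℝ :=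
  ∑ s ∈ antidiagonal N with Even s.2, interferenceWeight f N s * (1 - 2 * T) ^ s.2

/-- Under `T ↦ 1 - T` the variable `1 - 2T` changes sign, so the odd part of the invariant sum
equals its own negative. -/
theorem puritySector_eq_sectorPurity (f : ℕ → ℂ) (T : ℝ) (N : ℕ) :
    puritySector f T N = (sectorPurity f N T : ℂ) := by
  have h1 := puritySector_eq_sum f T N
  have h2 := puritySector_eq_sum f (1 - T) N
  rw [puritySector_one_sub, h1, Complex.ofReal_inj] at h2
  rw [h1, Complex.ofReal_inj, sectorPurity]
  rw [← Finset.sum_filter_add_sum_filter_not (antidiagonal N) (fun s => Even s.2),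
    ← Finset.sum_filter_add_sum_filter_not (antidiagonal N) (fun s => Even s.2)
      fun s => interferenceWeight f N s * (1 - 2 * (1 - T)) ^ s.2] at h2
  rw [← Finset.sum_filter_add_sum_filter_not (antidiagonal N) (fun s => Even s.2)]
  have heven : ∑ s ∈ antidiagonal N with Even s.2,
      interferenceWeight f N s * (1 - 2 * (1 - T)) ^ s.2 =
        ∑ s ∈ antidiagonal N with Even s.2, interferenceWeight f N s * (1 - 2 * T) ^ s.2 :=
    Finset.sum_congr rfl fun s hs => by
      rw [show 1 - 2 * (1 - T) = -(1 - 2 * T) by ring, (Finset.mem_filter.1 hs).2.neg_pow]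
  have hodd : ∑ s ∈ antidiagonal N with ¬ Even s.2,
      interferenceWeight f N s * (1 - 2 * (1 - T)) ^ s.2 =
        -∑ s ∈ antidiagonal N with ¬ Even s.2, interferenceWeight f N s * (1 - 2 * T) ^ s.2 := by
    rw [← Finset.sum_neg_distrib]
    exact Finset.sum_congr rfl fun s hs => by
      rw [show 1 - 2 * (1 - T) = -(1 - 2 * T) by ring,
        (Nat.not_even_iff_odd.1 (Finset.mem_filter.1 hs).2).neg_pow, mul_neg]
  rw [heven, hodd] at h2
  linarith

/-! ### Convexity and the minimum at the balanced point -/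

theorem hasSum_sectorPurity (ψ : Fock) {T : ℝ} (hT : T ∈ Set.Icc (0 : ℝ) 1) :
    HasSum (fun N => sectorPurity (fun n => ψ n * (√(n ! : ℝ) : ℂ)) N T) (outputPurity ψ T) := by
  have h := hasSum_puritySector ψ hT
  refine Complex.hasSum_ofReal.1 ?_
  convert h using 2 with N
  exact (puritySector_eq_sectorPurity _ T N).symm

theorem convexOn_sectorPurity (f : ℕ → ℂ) (N : ℕ) : ConvexOn ℝ Set.univ (sectorPurity f N) := by
  refine ⟨convex_univ, fun x _ y _ a b ha hb hab => ?_⟩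
  simp only [sectorPurity, smul_eq_mul, Finset.mul_sum, ← Finset.sum_add_distrib]
  refine Finset.sum_le_sum fun s hs => ?_
  have h := (Finset.mem_filter.1 hs).2.convexOn_pow.2 (Set.mem_univ (1 - 2 * x))
    (Set.mem_univ (1 - 2 * y)) ha hb hab
  simp only [smul_eq_mul] at h
  have h' := mul_le_mul_of_nonneg_left h (interferenceWeight_nonneg f N s)
  rw [show a * (1 - 2 * x) + b * (1 - 2 * y) = 1 - 2 * (a * x + b * y) by linear_combination hab]
    at h'
  linarith

theorem sectorPurity_half_le (f : ℕ → ℂ) (N : ℕ) (T : ℝ) :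
    sectorPurity f N (1 / 2) ≤ sectorPurity f N T := by
  refine Finset.sum_le_sum fun s hs => mul_le_mul_of_nonneg_left ?_ (interferenceWeight_nonneg f N s)
  have he := (Finset.mem_filter.1 hs).2
  -- At `T = 1/2` only the constant term survives; every other even power vanishes there and is
  -- nonnegative elsewhere.
  rcases Nat.eq_zero_or_pos s.2 with h0 | h0
  · simp [h0]
  · rw [show (1 - 2 * (1 / 2) : ℝ) = 0 by norm_num, zero_pow h0.ne']
    exact he.pow_nonneg _

theorem convexOn_outputPurity (ψ : Fock) : ConvexOn ℝ (Set.Icc 0 1) (outputPurity ψ) := by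
  refine ⟨convex_Icc 0 1, fun x hx y hy a b ha hb hab => ?_⟩
  refine hasSum_le (fun N => (convexOn_sectorPurity _ N).2 (Set.mem_univ x) (Set.mem_univ y)
    ha hb hab) (hasSum_sectorPurity ψ (convex_Icc 0 1 hx hy ha hb hab)) ?_
  exact ((hasSum_sectorPurity ψ hx).mul_left a).add ((hasSum_sectorPurity ψ hy).mul_left b)

theorem isMinOn_outputPurity (ψ : Fock) : IsMinOn (outputPurity ψ) (Set.Icc 0 1) (1 / 2) :=
  isMinOn_iff.2 fun _ hT => hasSum_le (fun N => sectorPurity_half_le _ N _)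
    (hasSum_sectorPurity ψ ⟨by norm_num, by norm_num⟩) (hasSum_sectorPurity ψ hT)

end BeamSplitter

end

theorem corollary2 (ψ : BeamSplitter.Fock) (hψ : ‖ψ‖ = 1) :
    ConvexOn ℝ (Set.Icc 0 1) (BeamSplitter.outputPurity ψ) ∧
      IsMinOn (BeamSplitter.outputPurity ψ) (Set.Icc 0 1) (1 / 2) ∧
      ConcaveOn ℝ (Set.Icc 0 1) (BeamSplitter.outputMixedness ψ) ∧
      IsMaxOn (BeamSplitter.outputMixedness ψ) (Set.Icc 0 1) (1 / 2) := by
  have hconv := BeamSplitter.convexOn_outputPurity ψ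
  have hmin := BeamSplitter.isMinOn_outputPurity ψ
  exact ⟨hconv, hmin, (concaveOn_const (1 : ℝ) (convex_Icc 0 1)).sub hconv,
    isMaxOn_iff.2 fun T hT => sub_le_sub_left (isMinOn_iff.1 hmin T hT) 1⟩
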